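/- Let $a\ge -1$ be an integer, and let $\rho>a+1$ and $\rho'\in(-2,-1)$ be the roots in these intervals of the polynomial $x^3-ax^2-(a+3)x-1$ (a "simplest cubic field" polynomial; all three of its roots are real and lie in the totally real cubic field $K=\mathbb{Q}(\rho)$). The signature of $\alpha\in K$ is the tuple $\mathfrak{s}(\alpha)$ of the signs of $\sigma(\alpha)$, where $\sigma$ runs through the embeddings of $K$ into $\mathbb{R}$. For a signature $\mathfrak{s}$, an element $\alpha\in\mathbb{Z}[\rho]$ of signature $\mathfrak{s}$ is called $\mathfrak{s}$-indecomposable if it is not the sum of two elements of $\mathbb{Z}[\rho]$ of signature $\mathfrak{s}$. The Jacobi–Perron (JPA) expansion of $\beta^{(0)}=(\beta^{(0)}_1,\dots,\beta^{(0)}_n)\in\mathbb{R}^n$ is the sequence of vectors given by $$\beta^{(k+1)}=\bigl(\beta_2^{(k)}-b_2^{(k)}\beta_1^{(k)},\dots,\beta_n^{(k)}-b_n^{(k)}\beta_1^{(k)},\beta_1^{(k)}\bigr),\qquad b_i^{(k)}=\bigl\lfloor \beta_i^{(k)}/\beta_1^{(k)}\bigr\rfloor ,$$ and its semiconvergents are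 the numbers $\beta_i^{(k)}-j\beta_1^{(k)}$ with $k\ge 0$, $2\le i\le n$ and $0\le j\le b_i^{(k)}-1$. Then every semiconvergent $\delta$ of the JPA expansion of $(1,-\rho',\rho'^2)$ lies in $\mathbb{Z}[\rho]$ and is $\mathfrak{s}$-indecomposable in its signature $\mathfrak{s}=\mathfrak{s}(\delta)$. Moreover, $\delta=\varepsilon\alpha$, where $\varepsilon$ is a unit of $\mathbb{Z}[\rho]$ and $\alpha$ is a totally positive indecomposable element of $\mathbb{Z}[\rho]$ (that is, $\mathfrak{s}$-indecomposable for $\mathfrak{s}=(+,+,+)$) which is either $1$ or one of the elements $$\theta'_{v,W}=-v-\bigl(v(a+2)+1+W\bigr)\rho'+(v+1)\rho'^2,\qquad 0\le v\le a,\quad 0\le W\le a-v.$$ -/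

import Mathlib

/-! ### Signatures and indecomposable elements -/

/-- The signature of `x`: the family of the signs of its images under all embeddings `K → ℝ`.
It is used for totally real number fields `K`. -/
noncomputable def signature {K : Type*} [Field K] (x : K) : (K →+* ℝ) → SignType :=
  fun σ => SignType.sign (σ x)

/-- `x` is an `s`-indecomposable element of the order `O`: it lies in `O`, has signature `s`,
and is not a sum of two elements of `O` of signature `s`. -/
def IsSIndecomposable {K : Type*} [Field K] (O : Subalgebra ℤ K) (s : (K →+* ℝ) → SignType)
    (x : K) : Prop :=
  (x ∈ O ∧ signature x = s) ∧
    ¬ ∃ y ∈ O, ∃ z ∈ O, signature y = s ∧ signature z = s ∧ x = y + z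

/-- The signature `(+, +, …, +)`. -/
def totallyPositive (K : Type*) [Field K] : (K →+* ℝ) → SignType := fun _ => 1

/-! ### The homogeneous Jacobi--Perron algorithm

A vector `(β₁, …, β_{n+1})` is a function on `Fin (n + 1)`; `β 0` is its first coordinate. -/

/-- One step of the algorithm:
`(β₁, …, β_{n+1}) ↦ (β₂ - b₂ β₁, …, β_{n+1} - b_{n+1} β₁, β₁)` with `bᵢ = ⌊βᵢ / β₁⌋`. -/
noncomputable def jpaStep {n : ℕ} (β : Fin (n + 1) → ℝ) : Fin (n + 1) → ℝ :=
  Fin.snoc (α := fun _ => ℝ) (fun i : Fin n => β i.succ - ⌊β i.succ / β 0⌋ * β 0) (β 0)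

/-- The `k`-th vector of the Jacobi--Perron expansion of `β`. -/
noncomputable def jpa {n : ℕ} (β : Fin (n + 1) → ℝ) (k : ℕ) : Fin (n + 1) → ℝ :=
  jpaStep^[k] β

/-- `δ` is a semiconvergent of the Jacobi--Perron expansion of `β`: it equals
`βᵢ⁽ᵏ⁾ - j β₁⁽ᵏ⁾` for some `k ≥ 0`, some coordinate `i` other than the first one and some
`0 ≤ j ≤ ⌊βᵢ⁽ᵏ⁾ / β₁⁽ᵏ⁾⌋ - 1`. -/
def IsSemiconvergent {n : ℕ} (β : Fin (n + 1) → ℝ) (δ : ℝ) : Prop :=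
  ∃ (k : ℕ) (i : Fin n) (j : ℕ),
    (j : ℤ) ≤ ⌊jpa β k i.succ / jpa β k 0⌋ - 1 ∧ δ = jpa β k i.succ - j * jpa β k 0

/-! ### The simplest cubic fields -/

/-- The real number field `ℚ(ρ)`. -/
noncomputable abbrev realField (ρ : ℝ) : IntermediateField ℚ ℝ :=
  IntermediateField.adjoin ℚ {ρ}

/-- The order `ℤ[ρ]` of `ℚ(ρ)`. -/
noncomputable abbrev realOrder (ρ : ℝ) : Subalgebra ℤ (realField ρ) :=
  Algebra.adjoin ℤ {IntermediateField.AdjoinSimple.gen ℚ ρ}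

/-- `-v - (v(a+2) + 1 + W) x + (v+1) x²`. -/
def triangleElement (a : ℤ) (v W : ℕ) (x : ℝ) : ℝ :=
  -v - (v * (a + 2) + 1 + W) * x + (v + 1) * x ^ 2

/-! Put `e = 1/ρ` and `t = 1 + e`. Both are units of `ℤ[ρ]`, and `-ρ' = t`, so the vector to expand
is `(1, t, t²)`.

The algorithm commutes with scaling, and up to unit factors this expansion is eventually periodic.
It therefore suffices to exhibit a finite set of vectors that each step maps into itself up to a
unit, and to inspect the semiconvergents of these vectors (`semiconvergent_of_stepsInto`). The
digits follow from bounds such as `1/(a+2) < e < 1/(a+1)` for `a ≥ 0`, and the cycle has a different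
shape for `a = -1`, `a = 0`, `1 ≤ a ≤ 3` and `a ≥ 4`. Each semiconvergent is a unit, or a unit times
some `θ'_{v,W}`, by an explicit identity modulo the cubic relation for `e`.

For indecomposability, `1, t, t²` is an integral basis of `ℤ[ρ]`, and `p + q t + r t² ↦ p + r` is a
positive combination of the three real embeddings (`exists_weights`). It is thus a positive integer
on every totally positive element, so a totally positive element of value 1 cannot split. Both `1`
and `θ'_{v,W}`, where `p = -v` and `r = v + 1`, have value 1. Multiplication by a unit carries
indecomposability over to other signatures. -/

/-! ### Jacobi–Perron expansions up to scaling. -/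

theorem jpaStep_smul {n : ℕ} {c : ℝ} (hc : c ≠ 0) (β : Fin (n + 1) → ℝ) :
    jpaStep (c • β) = c • jpaStep β := by
  funext i
  refine Fin.lastCases ?_ (fun i => ?_) i
  · simp [jpaStep]
  · simp only [jpaStep, Fin.snoc_castSucc, Pi.smul_apply, smul_eq_mul]
    rw [mul_div_mul_left _ _ hc]
    ring

theorem jpaStep_vec3 {x y z : ℝ} {b c : ℤ} (hx : 0 < x) (hb : b * x ≤ y) (hb' : y < (b + 1) * x)
    (hc : c * x ≤ z) (hc' : z < (c + 1) * x) :
    ⌊y / x⌋ = b ∧ ⌊z / x⌋ = c ∧ jpaStep ![x, y, z] = ![y - b * x, z - c * x, x] := by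
  have h1 : ⌊y / x⌋ = b := by
    rw [Int.floor_eq_iff, le_div_iff₀ hx, div_lt_iff₀ hx]
    exact ⟨hb, hb'⟩
  have h2 : ⌊z / x⌋ = c := by
    rw [Int.floor_eq_iff, le_div_iff₀ hx, div_lt_iff₀ hx]
    exact ⟨hc, hc'⟩
  refine ⟨h1, h2, ?_⟩
  funext i
  fin_cases i
  · simp [jpaStep, Fin.snoc, h1]
  · simp [jpaStep, Fin.snoc, h2]
  · simp [jpaStep, Fin.snoc]

/-- A vector `(x, y, z)` with JPA digits `b, c` whose semiconvergents satisfy `G` and whose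
successor lies in `V` up to a factor in `U`. -/
def StepsInto (U : Subgroup ℝˣ) (G : ℝ → Prop) (V : Set (Fin 3 → ℝ)) (x y z : ℝ) : Prop :=
  ∃ b c : ℤ, 0 < x ∧ b * x ≤ y ∧ y < (b + 1) * x ∧ c * x ≤ z ∧ z < (c + 1) * x ∧
    (∀ j : ℤ, 0 ≤ j → j < b → G (y - j * x)) ∧ (∀ j : ℤ, 0 ≤ j → j < c → G (z - j * x)) ∧
    ∃ u ∈ U, ∃ v ∈ V, ![y - b * x, z - c * x, x] = (u : ℝ) • v

/-- Digits depend only on ratios of coordinates, so by induction every vector of the expansion is an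
element of `U` times a member of `V`. Its semiconvergents scale by the same factor, which `G`
tolerates. -/
theorem semiconvergent_of_stepsInto {U : Subgroup ℝˣ} {G : ℝ → Prop} {V : Set (Fin 3 → ℝ)}
    (hG : ∀ u ∈ U, ∀ δ, G δ → G ((u : ℝ) * δ))
    (hV : ∀ v ∈ V, StepsInto U G V (v 0) (v 1) (v 2)) {v : Fin 3 → ℝ} (hv : v ∈ V) {δ : ℝ}
    (hδ : IsSemiconvergent v δ) : G δ := by
  have eta : ∀ v : Fin 3 → ℝ, v = ![v 0, v 1, v 2] := fun v => by
    funext i; fin_cases i <;> rfl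
  have inv : ∀ k, ∃ u ∈ U, ∃ w ∈ V, jpa v k = (u : ℝ) • w := by
    intro k
    induction k with
    | zero => exact ⟨1, U.one_mem, v, hv, by simp [jpa]⟩
    | succ k ih =>
      obtain ⟨u, hu, w, hw, h⟩ := ih
      obtain ⟨b, c, hx, h1, h2, h3, h4, -, -, u', hu', w', hw', h'⟩ := hV w hw
      refine ⟨u * u', U.mul_mem hu hu', w', hw', ?_⟩
      have h5 := (jpaStep_vec3 hx h1 h2 h3 h4).2.2
      rw [← eta w, h'] at h5
      have : jpa v (k + 1) = jpaStep (jpa v k) := by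
        simp only [jpa, Function.iterate_succ_apply']
      rw [this, h, jpaStep_smul u.ne_zero, h5, smul_smul, Units.val_mul]
  obtain ⟨k, i, j, hj, rfl⟩ := hδ
  obtain ⟨u, hu, w, hw, h⟩ := inv k
  obtain ⟨b, c, hx, h1, h2, h3, h4, hb, hc, -⟩ := hV w hw
  obtain ⟨h5, h6, -⟩ := jpaStep_vec3 hx h1 h2 h3 h4
  rw [h] at hj ⊢
  simp only [Pi.smul_apply, smul_eq_mul] at hj ⊢
  rw [mul_div_mul_left _ _ u.ne_zero] at hj
  have e : (u : ℝ) * w i.succ - j * (u * w 0) = u * (w i.succ - j * w 0) := by ring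
  rw [e]
  apply hG u hu
  fin_cases i
  · change (j : ℤ) ≤ ⌊w 1 / w 0⌋ - 1 at hj
    rw [h5] at hj
    simpa using hb j (by positivity) (by omega)
  · change (j : ℤ) ≤ ⌊w 2 / w 0⌋ - 1 at hj
    rw [h6] at hj
    simpa using hc j (by positivity) (by omega)

/-- `-v + (v(a+2) + 1 + W) t + (v+1) t²`. -/
def trianglePoly (a v W : ℤ) (t : ℝ) : ℝ :=
  -v + (v * (a + 2) + 1 + W) * t + (v + 1) * t ^ 2

/-- `δ` is an element of `U`, possibly times a triangle element. -/
def IsUnitMulTriangle (U : Subgroup ℝˣ) (a : ℤ) (t δ : ℝ) : Prop :=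
  ∃ u ∈ U, δ = (u : ℝ) ∨
    ∃ v W : ℤ, 0 ≤ v ∧ 0 ≤ W ∧ v + W ≤ a ∧ δ = (u : ℝ) * trianglePoly a v W t

/-- `e` and `t = 1 + e` are elements of `U`, where `e` is the positive root of
`x³ + (a+3)x² + ax - 1`. -/
structure CubicUnits (U : Subgroup ℝˣ) (a : ℤ) (e t : ℝˣ) : Prop where
  mem_e : e ∈ U
  mem_t : t ∈ U
  t_eq : (t : ℝ) = 1 + e
  pos : 0 < (e : ℝ)
  rel : a * (e : ℝ) + (a + 3) * (e : ℝ) ^ 2 + (e : ℝ) ^ 3 = 1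

theorem IsUnitMulTriangle.unit_mul {U : Subgroup ℝˣ} {a : ℤ} {t : ℝ} (u : ℝˣ) (hu : u ∈ U) (δ : ℝ)
    (h : IsUnitMulTriangle U a t δ) : IsUnitMulTriangle U a t (u * δ) := by
  obtain ⟨c, hc, h⟩ := h
  refine ⟨u * c, U.mul_mem hu hc, ?_⟩
  rcases h with h | ⟨v, W, h1, h2, h3, h⟩
  · left; rw [h, Units.val_mul]
  · right; exact ⟨v, W, h1, h2, h3, by rw [h, Units.val_mul]; ring⟩

theorem isUnitMulTriangle_of_mul_eq_unit {U : Subgroup ℝˣ} {a : ℤ} {t δ : ℝ} {c d : ℝˣ}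
    (hc : c ∈ U) (hd : d ∈ U) (h : δ * c = d) : IsUnitMulTriangle U a t δ :=
  ⟨d * c⁻¹, U.mul_mem hd (U.inv_mem hc), Or.inl (by simp [← h])⟩

theorem isUnitMulTriangle_of_mul_eq {U : Subgroup ℝˣ} {a : ℤ} {t δ : ℝ} {c d : ℝˣ}
    (hc : c ∈ U) (hd : d ∈ U) (v W : ℤ) (hv : 0 ≤ v) (hW : 0 ≤ W) (hvW : v + W ≤ a)
    (h : δ * c = d * trianglePoly a v W t) : IsUnitMulTriangle U a t δ := by
  refine ⟨d * c⁻¹, U.mul_mem hd (U.inv_mem hc), Or.inr ⟨v, W, hv, hW, hvW, ?_⟩⟩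
  have := c.ne_zero
  rw [Units.val_mul, Units.val_inv_eq_inv_val]
  field_simp
  exact h

namespace CubicUnits

variable {U : Subgroup ℝˣ} {a : ℤ} {e t : ℝˣ}

theorem isUnitMulTriangle_unit {u : ℝˣ} {δ : ℝ} (hu : u ∈ U) (h : δ = u) :
    IsUnitMulTriangle U a t δ := ⟨u, hu, Or.inl h⟩

theorem isUnitMulTriangle_one : IsUnitMulTriangle U a t 1 :=
  isUnitMulTriangle_unit U.one_mem (by simp)

/-! #### Families of multiples of triangle elements -/

theorem one_sub_mul (H : CubicUnits U a e t) {j : ℤ} (hj : 0 ≤ j) (hja : j ≤ a) :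
    IsUnitMulTriangle U a t (1 - j * e) := by
  -- The value `j = 0` is separate: it would give `v = a + 1`, outside the triangle.
  rcases hj.eq_or_lt with rfl | hj
  · simpa using isUnitMulTriangle_one
  · refine isUnitMulTriangle_of_mul_eq (U.pow_mem H.mem_t 2) (U.pow_mem H.mem_e 2) (a + 1 - j) 0
      (by omega) le_rfl (by omega) ?_
    have R := H.rel
    simp only [trianglePoly, Units.val_pow_eq_pow_val, H.t_eq]
    push_cast
    generalize (e : ℝ) = e at *
    linear_combination (-1 - (a + 2 - j) * e) * R

theorem one_sub_mul_sub (H : CubicUnits U a e t) {i j : ℤ} (hj : 1 ≤ j) (hi : 0 ≤ i)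
    (hij : 2 * j + i ≤ a) :
    IsUnitMulTriangle U a t (1 - j * (2 * e + e ^ 2) - i * e) := by
  refine isUnitMulTriangle_of_mul_eq H.mem_t (U.pow_mem H.mem_e 2) (a - 2 * j - i) (j + 1 + i)
      (by omega) (by omega) (by omega) ?_
  have R := H.rel
  simp only [trianglePoly, Units.val_pow_eq_pow_val, H.t_eq]
  push_cast
  generalize (e : ℝ) = e at *
  linear_combination (-1 - (a - 2 * j - i + 1) * e) * R

theorem add_self (H : CubicUnits U a e t) {k : ℤ} (hk : 1 ≤ k) (hka : k ≤ a + 2) :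
    IsUnitMulTriangle U a t (k + e) := by
  -- For `k = 1` the formula would need `W = -1`; the element is then the unit `t`.
  rcases hk.eq_or_lt with rfl | hk
  · exact isUnitMulTriangle_unit H.mem_t (by simp [H.t_eq])
  · refine isUnitMulTriangle_of_mul_eq H.mem_t U.one_mem 0 (k - 2)
      (by omega) (by omega) (by omega) ?_
    simp only [trianglePoly, H.t_eq, Units.val_one]
    push_cast
    ring

/-- The bracket is `e / t` in polynomial form, see `div_mul`. -/
theorem add_div (H : CubicUnits U a e t) {k : ℤ} (hk : 1 ≤ k) (hka : k ≤ a + 1) :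
    IsUnitMulTriangle U a t (k + ((a + 2) * e + e ^ 2 - 1)) := by
  refine isUnitMulTriangle_of_mul_eq H.mem_t H.mem_e (k - 1) (a + 1 - k)
      (by omega) (by omega) (by omega) ?_
  have R := H.rel
  simp only [trianglePoly, H.t_eq]
  push_cast
  generalize (e : ℝ) = e at *
  linear_combination (1 - k) * R

/-- For `a = -1` the element `1 + t` is a unit. -/
theorem add_self_two (H : CubicUnits U a e t) (ha : -1 ≤ a) :
    IsUnitMulTriangle U a t (2 + e) := by
  rcases ha.eq_or_lt with rfl | ha
  · refine isUnitMulTriangle_of_mul_eq_unit (U.pow_mem H.mem_e 2) H.mem_t ?_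
    have R := H.rel
    push_cast at R ⊢
    rw [H.t_eq]
    generalize (e : ℝ) = e at *
    linear_combination R
  · simpa using H.add_self (k := 2) (by norm_num) (by omega)

end CubicUnits

namespace CubicUnits

variable {U : Subgroup ℝˣ} {a : ℤ} {e t : ℝˣ}

/-! #### Inequalities -/

/-- `e / t`, written as a polynomial. -/
theorem div_mul (H : CubicUnits U a e t) :
    ((a + 2) * (e : ℝ) + (e : ℝ) ^ 2 - 1) * (1 + e) = e := by
  linear_combination H.rel

theorem val_div (H : CubicUnits U a e t) :
    ((e * t⁻¹ : ℝˣ) : ℝ) = (a + 2) * e + (e : ℝ) ^ 2 - 1 := by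
  rw [Units.val_mul, Units.val_inv_eq_inv_val, ← div_eq_mul_inv, div_eq_iff t.ne_zero, H.t_eq,
    H.div_mul]

theorem div_pos' (H : CubicUnits U a e t) : 0 < (a + 2) * (e : ℝ) + (e : ℝ) ^ 2 - 1 := by
  rw [← H.val_div, Units.val_mul, Units.val_inv_eq_inv_val, H.t_eq]
  have := H.pos
  positivity

theorem div_lt (H : CubicUnits U a e t) : (a + 2) * (e : ℝ) + (e : ℝ) ^ 2 - 1 < e := by
  have h := H.div_mul
  have := mul_pos H.div_pos' H.pos
  linarith

theorem lt_one (H : CubicUnits U a e t) (ha : -1 ≤ a) : (e : ℝ) < 1 := by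
  have h := H.rel
  have hp := H.pos
  have ha' : (-1 : ℝ) ≤ a := by exact_mod_cast ha
  by_contra! h1
  nlinarith [mul_nonneg (sub_nonneg.2 h1) hp.le, mul_nonneg (sub_nonneg.2 h1) (sq_nonneg (e : ℝ)),
    mul_nonneg (by linarith : (0 : ℝ) ≤ a + 1) hp.le,
    mul_nonneg (by linarith : (0 : ℝ) ≤ a + 1) (sq_nonneg (e : ℝ))]

theorem one_sub_pos (H : CubicUnits U a e t) : 0 < 1 - (a + 1) * (e : ℝ) - (e : ℝ) ^ 2 := by
  have h := mul_pos H.pos H.div_pos'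
  linarith [H.rel]

theorem one_lt (H : CubicUnits U a e t) (ha : 0 ≤ a) : 1 < (a + 2) * (e : ℝ) := by
  have h := H.one_sub_pos
  have hp := H.pos
  have ha' : (0 : ℝ) ≤ a := by exact_mod_cast ha
  have h1 : 0 < e * (1 - e - (e : ℝ) ^ 2) := mul_pos hp (by nlinarith)
  have h2 : ((a + 2) * (e : ℝ) - 1) * (1 + e) = e * (1 - e - (e : ℝ) ^ 2) := by
    linear_combination H.rel
  by_contra! h3
  nlinarith

theorem sq_add_lt_one (H : CubicUnits U a e t) (ha : 1 ≤ a) : 2 * (e : ℝ) + (e : ℝ) ^ 2 < 1 := by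
  have h := H.one_sub_pos
  have ha' : (1 : ℝ) ≤ a := by exact_mod_cast ha
  nlinarith [H.pos]

/-! #### The vectors of the expansion -/

variable {V : Set (Fin 3 → ℝ)}

theorem smul_vec3 (c x y z : ℝ) : c • ![x, y, z] = ![c * x, c * y, c * z] := by
  simp

theorem vec3_eq {x y z x' y' z' : ℝ} (h1 : x = x') (h2 : y = y') (h3 : z = z') :
    ![x, y, z] = ![x', y', z'] := by rw [h1, h2, h3]

theorem isUnitMulTriangle_congr {δ δ' : ℝ} (h : IsUnitMulTriangle U a t δ) (h' : δ' = δ) :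
    IsUnitMulTriangle U a t δ' := h' ▸ h

theorem e_mul (H : CubicUnits U a e t) {δ : ℝ} (h : IsUnitMulTriangle U a t δ) :
    IsUnitMulTriangle U a t (e * δ) := h.unit_mul e H.mem_e

theorem self_e (H : CubicUnits U a e t) : IsUnitMulTriangle U a t e :=
  isUnitMulTriangle_unit H.mem_e rfl

theorem self_t (H : CubicUnits U a e t) : IsUnitMulTriangle U a t (1 + e) :=
  isUnitMulTriangle_unit H.mem_t H.t_eq.symm

theorem two_mul_add (H : CubicUnits U a e t) (ha : -1 ≤ a) :
    IsUnitMulTriangle U a t (2 * e + e ^ 2) :=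
  isUnitMulTriangle_congr (H.e_mul (H.add_self_two ha)) (by ring)

theorem add_sq (H : CubicUnits U a e t) : IsUnitMulTriangle U a t (e + e ^ 2) :=
  isUnitMulTriangle_congr (H.e_mul H.self_t) (by ring)

/-- This is the case `j = a + 1` missing from `one_sub_mul`: the element equals `e² t⁻¹ (2 + e)`. -/
theorem one_sub_add_one_mul (H : CubicUnits U a e t) (ha : -1 ≤ a) :
    IsUnitMulTriangle U a t (1 - (a + 1) * e) := by
  refine isUnitMulTriangle_congr (IsUnitMulTriangle.unit_mul (e ^ 2 * t⁻¹)
    (U.mul_mem (U.pow_mem H.mem_e 2) (U.inv_mem H.mem_t)) _ (H.add_self_two ha)) ?_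
  have : ((e ^ 2 * t⁻¹ : ℝˣ) : ℝ) = e * ((a + 2) * e + (e : ℝ) ^ 2 - 1) := by
    rw [← H.val_div, pow_two, mul_assoc, Units.val_mul]
  rw [this]
  linear_combination -(1 + (e : ℝ)) * H.rel

theorem steps_initial (H : CubicUnits U a e t) (ha : 1 ≤ a)
    (hV : (![(e : ℝ), 2 * e + e ^ 2, 1] : Fin 3 → ℝ) ∈ V) :
    StepsInto U (IsUnitMulTriangle U a t) V 1 (1 + (e : ℝ)) ((1 + (e : ℝ)) ^ 2) := by
  have h1 := H.sq_add_lt_one ha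
  have h2 := H.pos
  refine ⟨1, 1, one_pos, ?_, ?_, ?_, ?_, ?_, ?_, 1, U.one_mem, _, hV, ?_⟩
  · push_cast; linarith
  · push_cast; nlinarith
  · push_cast; nlinarith
  · push_cast; nlinarith
  · intro j h h'
    obtain rfl : j = 0 := by omega
    simpa using H.self_t
  · intro j h h'
    obtain rfl : j = 0 := by omega
    exact isUnitMulTriangle_congr (H.self_t.unit_mul t H.mem_t) (by rw [H.t_eq]; push_cast; ring)
  · rw [smul_vec3]
    apply vec3_eq <;> (push_cast; ring)

theorem steps_from_e_one (H : CubicUnits U a e t) (ha : 1 ≤ a)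
    (hV : (![(e : ℝ) ^ 2, 1 - (a + 1) * e, e] : Fin 3 → ℝ) ∈ V) :
    StepsInto U (IsUnitMulTriangle U a t) V e (2 * e + e ^ 2) 1 := by
  have h1 := H.lt_one (by omega)
  have h2 := H.pos
  have h3 := H.one_sub_pos
  have h4 := H.div_pos'
  have h5 := H.div_lt
  have h6 := H.one_lt (by omega)
  refine ⟨2, a + 1, h2, ?_, ?_, ?_, ?_, ?_, ?_, 1, U.one_mem, _, hV, ?_⟩
  · push_cast; nlinarith
  · push_cast; nlinarith
  · push_cast; nlinarith
  · push_cast; nlinarith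
  · intro j h h'
    obtain rfl | rfl : j = 0 ∨ j = 1 := by omega
    · simpa using H.two_mul_add (by omega)
    · exact isUnitMulTriangle_congr H.add_sq (by push_cast; ring)
  · intro j h h'
    exact H.one_sub_mul h (by omega)
  · rw [smul_vec3]
    apply vec3_eq <;> (push_cast; ring)

/-- The new first coordinate `1 - (a+1)e - e²` equals `e · (e/t)`; dividing by this unit gives the
next vector. -/
theorem steps_from_sq_e (H : CubicUnits U a e t) (ha : 0 ≤ a)
    (hV : (![1, 2 * (e : ℝ) + e ^ 2, 1 + (e : ℝ)] : Fin 3 → ℝ) ∈ V) :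
    StepsInto U (IsUnitMulTriangle U a t) V ((e : ℝ) ^ 2) (1 - (a + 1) * e) e := by
  have h1 := H.lt_one (by omega)
  have h2 := H.pos
  have h3 := H.one_sub_pos
  have h4 := H.div_pos'
  have h5 := H.div_lt
  have R := H.rel
  have h6 := H.one_lt ha
  refine ⟨1, a + 1, by positivity, ?_, ?_, ?_, ?_, ?_, ?_, e * (e * t⁻¹),
    U.mul_mem H.mem_e (U.mul_mem H.mem_e (U.inv_mem H.mem_t)), _, hV, ?_⟩
  · push_cast; nlinarith
  · push_cast; nlinarith
  · push_cast; nlinarith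
  · push_cast; nlinarith
  · intro j h h'
    obtain rfl : j = 0 := by omega
    simpa using H.one_sub_add_one_mul (by omega)
  · intro j h h'
    exact isUnitMulTriangle_congr (H.e_mul (H.one_sub_mul (j := j) h (by omega))) (by ring)
  · rw [smul_vec3, Units.val_mul, H.val_div]
    apply vec3_eq
    · linear_combination -R
    · push_cast; linear_combination (e : ℝ) * (-1 - e) * R
    · linear_combination -(e : ℝ) * R

/-- This closes the cycle: with `w = e/t` the first coordinate, `e - w = e²/t`, so the successor is
`t⁻¹` times an earlier vector. -/
theorem steps_return (H : CubicUnits U a e t) (ha : 0 ≤ a)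
    (hV : (![(e : ℝ) ^ 2, 1 - (a + 1) * e, e] : Fin 3 → ℝ) ∈ V) :
    StepsInto U (IsUnitMulTriangle U a t) V ((a + 2) * e + (e : ℝ) ^ 2 - 1) e 1 := by
  have h1 := H.lt_one (by omega)
  have h2 := H.pos
  have h3 := H.one_sub_pos
  have h4 := H.div_pos'
  have h5 := H.div_lt
  have R := H.rel
  have hdm := H.div_mul
  have h6 := mul_pos h4 h2
  have h7 := H.one_lt ha
  have e1 : (t : ℝ)⁻¹ = 2 - (a + 2) * e - (e : ℝ) ^ 2 := by
    rw [inv_eq_iff_eq_inv, eq_comm]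
    refine inv_eq_of_mul_eq_one_left ?_
    rw [H.t_eq]
    linear_combination -R
  refine ⟨1, a + 2, h4, ?_, ?_, ?_, ?_, ?_, ?_, t⁻¹, U.inv_mem H.mem_t, _, hV, ?_⟩
  · push_cast; linarith
  · push_cast; nlinarith
  · push_cast; nlinarith
  · push_cast; nlinarith
  · intro j h h'
    obtain rfl : j = 0 := by omega
    simpa using H.self_e
  · intro j h h'
    rcases h.eq_or_lt with rfl | h
    · simpa using isUnitMulTriangle_one
    -- Since `t w = e`, one has `t (1 - j w) = 1 - (j - 1) e`.
    · refine isUnitMulTriangle_congr (IsUnitMulTriangle.unit_mul t⁻¹ (U.inv_mem H.mem_t) _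
        (H.one_sub_mul (j := j - 1) (by omega) (by omega))) ?_
      rw [Units.val_inv_eq_inv_val, ← mul_right_inj' t.ne_zero, ← mul_assoc,
        mul_inv_cancel₀ t.ne_zero, H.t_eq]
      push_cast
      linear_combination -(j : ℝ) * R
  · rw [smul_vec3, Units.val_inv_eq_inv_val]
    rw [e1]
    apply vec3_eq
    · push_cast; linear_combination (-1 + (e : ℝ)) * R
    · push_cast; linear_combination (-(a : ℝ) - 1) * R
    · linear_combination R

theorem steps_from_one_t (H : CubicUnits U a e t) (ha : 1 ≤ a)
    (hV : (![2 * (e : ℝ) + e ^ 2, e, 1] : Fin 3 → ℝ) ∈ V) :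
    StepsInto U (IsUnitMulTriangle U a t) V 1 (2 * (e : ℝ) + (e : ℝ) ^ 2) (1 + (e : ℝ)) := by
  have h1 := H.sq_add_lt_one ha
  have h2 := H.pos
  refine ⟨0, 1, one_pos, ?_, ?_, ?_, ?_, ?_, ?_, 1, U.one_mem, _, hV, ?_⟩
  · push_cast; nlinarith
  · push_cast; nlinarith
  · push_cast; nlinarith
  · push_cast; nlinarith
  · intro j h h'
    omega
  · intro j h h'
    obtain rfl : j = 0 := by omega
    simpa using H.self_t
  · rw [smul_vec3]
    apply vec3_eq <;> (push_cast; ring)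

theorem steps_from_add_sq_e (H : CubicUnits U a e t) {m : ℤ} (hma : 2 * m ≤ a + 1)
    (h1 : m * (2 * (e : ℝ) + e ^ 2) ≤ 1) (h2 : 1 < (m + 1) * (2 * (e : ℝ) + e ^ 2))
    (hV : (![(e : ℝ), 1 - m * (2 * e + e ^ 2), 2 * e + e ^ 2] : Fin 3 → ℝ) ∈ V) :
    StepsInto U (IsUnitMulTriangle U a t) V (2 * e + (e : ℝ) ^ 2) e 1 := by
  have hp := H.pos
  refine ⟨0, m, by positivity, ?_, ?_, h1, ?_, ?_, ?_, 1, U.one_mem, _, hV, ?_⟩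
  · push_cast; nlinarith
  · push_cast; nlinarith
  · exact_mod_cast h2
  · intro j h h'
    omega
  · intro j h h'
    rcases h.eq_or_lt with rfl | h
    · simpa using isUnitMulTriangle_one
    · simpa using H.one_sub_mul_sub (i := 0) (j := j) (by omega) le_rfl (by omega)
  · rw [smul_vec3]
    apply vec3_eq <;> (push_cast; ring)

theorem steps_from_e_add_sq (H : CubicUnits U a e t) {m p : ℤ} (hm : 1 ≤ m) (hp : 0 ≤ p)
    (hmp : 2 * m + p ≤ a + 1)
    (h1 : p * (e : ℝ) ≤ 1 - m * (2 * (e : ℝ) + (e : ℝ) ^ 2))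
    (h2 : 1 - m * (2 * (e : ℝ) + (e : ℝ) ^ 2) < (p + 1) * (e : ℝ))
    (hV : ∃ u ∈ U, ∃ v ∈ V,
      ![1 - m * (2 * (e : ℝ) + (e : ℝ) ^ 2) - p * (e : ℝ), (e : ℝ) ^ 2, (e : ℝ)] = (u : ℝ) • v) :
    StepsInto U (IsUnitMulTriangle U a t) V (e : ℝ) (1 - m * (2 * (e : ℝ) + (e : ℝ) ^ 2))
      (2 * (e : ℝ) + (e : ℝ) ^ 2) := by
  have he := H.pos
  have hlt := H.lt_one (by omega)
  refine ⟨p, 2, he, h1, h2, ?_, ?_, ?_, ?_, ?_⟩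
  · push_cast; nlinarith
  · push_cast; nlinarith
  · intro j h h'
    exact H.one_sub_mul_sub hm h (by omega)
  · intro j h h'
    obtain rfl | rfl : j = 0 ∨ j = 1 := by omega
    · simpa using H.two_mul_add (by omega)
    · exact isUnitMulTriangle_congr H.add_sq (by push_cast; ring)
  · obtain ⟨u, hu, v, hv, h⟩ := hV
    refine ⟨u, hu, v, hv, ?_⟩
    rw [← h]
    apply vec3_eq <;> (push_cast; ring)

end CubicUnits

/-! ### Two further vectors for `a ≥ 4`, and the whole expansion for `a ≥ 1`. -/

namespace CubicUnits

variable {U : Subgroup ℝˣ} {a : ℤ} {e t : ℝˣ} {V : Set (Fin 3 → ℝ)}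

/-- The bounds on `k` give `1/2 < k e + e² < 1`, which forces the digits 0 and 1. -/
theorem steps_from_add_cube (H : CubicUnits U a e t) {k : ℤ} (hk : 1 ≤ k) (hka : a + 3 ≤ 2 * k)
    (hka' : k ≤ a + 1)
    (hV : (![(e : ℝ) ^ 2, e - (k * (e : ℝ) ^ 2 + (e : ℝ) ^ 3), k * (e : ℝ) ^ 2 + (e : ℝ) ^ 3] :
      Fin 3 → ℝ) ∈ V) :
    StepsInto U (IsUnitMulTriangle U a t) V (k * (e : ℝ) ^ 2 + (e : ℝ) ^ 3) ((e : ℝ) ^ 2) e := by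
  have he := H.pos
  have hlt := H.one_lt (by omega)
  have h3 := H.one_sub_pos
  have hk' : (1 : ℝ) ≤ k := by exact_mod_cast hk
  have hka1 : (a : ℝ) + 3 ≤ 2 * k := by exact_mod_cast hka
  have hka2 : (k : ℝ) ≤ a + 1 := by exact_mod_cast hka'
  have h4 : (k : ℝ) * e + (e : ℝ) ^ 2 < 1 := by nlinarith
  have h5 : 1 < 2 * ((k : ℝ) * e + (e : ℝ) ^ 2) := by nlinarith
  refine ⟨0, 1, by positivity, ?_, ?_, ?_, ?_, ?_, ?_, 1, U.one_mem, _, hV, ?_⟩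
  · push_cast; nlinarith
  · have : 0 < (e : ℝ) ^ 3 := by positivity
    push_cast; nlinarith [sq_nonneg (e : ℝ)]
  · push_cast; nlinarith
  · push_cast; nlinarith
  · intro j h h'
    omega
  · intro j h h'
    obtain rfl : j = 0 := by omega
    simpa using H.self_e
  · rw [smul_vec3]
    apply vec3_eq <;> (push_cast; ring)

theorem steps_from_sq_sub_cube (H : CubicUnits U a e t) {k : ℤ} (ha : 0 ≤ a) (hk : 1 ≤ k) (hka : k ≤ a + 2)
    (hV : (![(a + 2) * (e : ℝ) + (e : ℝ) ^ 2 - 1, e, 1] : Fin 3 → ℝ) ∈ V) :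
    StepsInto U (IsUnitMulTriangle U a t) V ((e : ℝ) ^ 2) (e - (k * (e : ℝ) ^ 2 + (e : ℝ) ^ 3))
      (k * (e : ℝ) ^ 2 + (e : ℝ) ^ 3) := by
  have he := H.pos
  have he1 := H.lt_one (by omega)
  have hw := H.div_pos'
  have hw1 : (a + 2) * (e : ℝ) + (e : ℝ) ^ 2 - 1 < 1 := H.div_lt.trans he1
  have he2 : 0 < (e : ℝ) ^ 2 := by positivity
  have R := H.rel
  -- After division by `e²` the second coordinate is `a + 1 - k` plus `e/t ∈ (0, 1)`, which shows
  -- the digit and the remainder.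
  have key : (e : ℝ) - (k * (e : ℝ) ^ 2 + (e : ℝ) ^ 3) =
      (a + 1 - k + ((a + 2) * (e : ℝ) + (e : ℝ) ^ 2 - 1)) * (e : ℝ) ^ 2 := by
    linear_combination -(e : ℝ) * R
  refine ⟨a + 1 - k, k, by positivity, ?_, ?_, ?_, ?_, ?_, ?_, e ^ 2, U.pow_mem H.mem_e 2, _, hV, ?_⟩
  · rw [key]; push_cast; nlinarith
  · rw [key]; push_cast; nlinarith
  · nlinarith
  · nlinarith
  · intro j h h'
    exact isUnitMulTriangle_congr ((H.add_div (k := a + 1 - k - j) (by omega) (by omega)).unit_mul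
      _ (U.pow_mem H.mem_e 2)) (by rw [key]; push_cast; ring)
  · intro j h h'
    exact isUnitMulTriangle_congr ((H.add_self (k := k - j) (by omega) (by omega)).unit_mul
      _ (U.pow_mem H.mem_e 2)) (by push_cast; ring)
  · rw [smul_vec3, key]
    apply vec3_eq <;> (push_cast; ring)

theorem semiconvergent_of_one_le (H : CubicUnits U a e t) (ha : 1 ≤ a) {δ : ℝ}
    (hδ : IsSemiconvergent ![1, 1 + (e : ℝ), (1 + (e : ℝ)) ^ 2] δ) :
    IsUnitMulTriangle U a t δ := by
  have he := H.pos
  have R := H.rel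
  have hlt := H.one_lt (by omega)
  have h3 := H.one_sub_pos
  -- For `a ≤ 3` the remainder in `steps_from_e_add_sq` is already `e · (e/t)`; for `a ≥ 4` two more
  -- vectors intervene.
  rcases le_or_gt a 3 with ha3 | ha3
  · let V : Set (Fin 3 → ℝ) := {![1, 1 + (e : ℝ), (1 + (e : ℝ)) ^ 2],
      ![(e : ℝ), 2 * (e : ℝ) + (e : ℝ) ^ 2, 1], ![(e : ℝ) ^ 2, 1 - (a + 1) * (e : ℝ), (e : ℝ)],
      ![1, 2 * (e : ℝ) + (e : ℝ) ^ 2, 1 + (e : ℝ)], ![2 * (e : ℝ) + (e : ℝ) ^ 2, (e : ℝ), 1],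
      ![(e : ℝ), 1 - (1 : ℤ) * (2 * (e : ℝ) + (e : ℝ) ^ 2), 2 * (e : ℝ) + (e : ℝ) ^ 2],
      ![(a + 2) * (e : ℝ) + (e : ℝ) ^ 2 - 1, (e : ℝ), 1]}
    refine semiconvergent_of_stepsInto (U := U) (V := V) IsUnitMulTriangle.unit_mul ?_
      (by simp only [V, Set.mem_insert_iff, true_or]) hδ
    rintro v (rfl | rfl | rfl | rfl | rfl | rfl | rfl)
    · exact H.steps_initial ha (by simp only [V, Set.mem_insert_iff, true_or, or_true])
    · exact H.steps_from_e_one ha (by simp only [V, Set.mem_insert_iff, true_or, or_true])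
    · exact H.steps_from_sq_e (by omega) (by simp only [V, Set.mem_insert_iff, true_or, or_true])
    · exact H.steps_from_one_t ha (by simp only [V, Set.mem_insert_iff, true_or, or_true])
    · refine H.steps_from_add_sq_e (m := 1) (by omega) ?_ ?_
        (by simp only [V, Set.mem_insert_iff, true_or, or_true])
      · have := H.sq_add_lt_one ha
        push_cast; linarith
      · have ha3' : (a : ℝ) ≤ 3 := by exact_mod_cast ha3
        have h1 : 0 < 4 * (e : ℝ) + 2 * (e : ℝ) ^ 2 - 1 := by
          have h2 : 1 ≤ 3 * (e : ℝ) + 6 * (e : ℝ) ^ 2 + (e : ℝ) ^ 3 := by nlinarith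
          by_contra! h4
          have h5 : 0 ≤ (e : ℝ) * (4 * e + (e : ℝ) ^ 2 - 1) := by linarith
          have h6 := nonneg_of_mul_nonneg_right h5 he
          nlinarith
        push_cast; linarith
    -- The remainder is `1 - (2e + e²) - (a-1)e = 1 - (a+1)e - e² = e · (e/t)`.
    · refine H.steps_from_e_add_sq (m := 1) (p := a - 1) le_rfl (by omega) (by omega) ?_ ?_
        ⟨e, H.mem_e, _, show ![(a + 2) * (e : ℝ) + (e : ℝ) ^ 2 - 1, (e : ℝ), 1] ∈ V by
          simp only [V, Set.mem_insert_iff, Set.mem_singleton_iff, or_true], ?_⟩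
      · push_cast; nlinarith
      · push_cast; nlinarith [H.div_pos']
      · rw [smul_vec3]
        apply vec3_eq
        · push_cast; linear_combination -R
        · ring
        · ring
    · exact H.steps_return (by omega) (by simp only [V, Set.mem_insert_iff, true_or, or_true])
  -- Here `m = ⌊a/2⌋ ≥ 2`, which is what makes `k = m + p + 3` at most `a + 1`.
  · obtain ⟨m, p, hmp, hp0, hp1⟩ : ∃ m p : ℤ, a = 2 * m + p ∧ 0 ≤ p ∧ p ≤ 1 :=
      ⟨a / 2, a % 2, by omega, by omega, by omega⟩
    have hmp' : (a : ℝ) = 2 * m + p := by exact_mod_cast hmp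
    have hm : (2 : ℝ) ≤ m := by exact_mod_cast (by omega : (2 : ℤ) ≤ m)
    have hp0' : (0 : ℝ) ≤ p := by exact_mod_cast hp0
    have hp1' : (p : ℝ) ≤ 1 := by exact_mod_cast hp1
    have hb : 0 < ((m + p + 3 : ℤ) : ℝ) * (e : ℝ) ^ 2 + (e : ℝ) ^ 3 := by push_cast; positivity
    have hb1 : ((m + p + 3 : ℤ) : ℝ) * (e : ℝ) ^ 2 + (e : ℝ) ^ 3 < e := by
      have : ((m + p + 3 : ℤ) : ℝ) * (e : ℝ) + (e : ℝ) ^ 2 < 1 := by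
        push_cast; nlinarith
      nlinarith
    have hbm : 1 - m * (2 * (e : ℝ) + (e : ℝ) ^ 2) - p * e =
        ((m + p + 3 : ℤ) : ℝ) * (e : ℝ) ^ 2 + (e : ℝ) ^ 3 := by
      rw [hmp'] at R; push_cast; linear_combination -R
    let V : Set (Fin 3 → ℝ) := {![1, 1 + (e : ℝ), (1 + (e : ℝ)) ^ 2],
      ![(e : ℝ), 2 * (e : ℝ) + (e : ℝ) ^ 2, 1], ![(e : ℝ) ^ 2, 1 - (a + 1) * (e : ℝ), (e : ℝ)],
      ![1, 2 * (e : ℝ) + (e : ℝ) ^ 2, 1 + (e : ℝ)], ![2 * (e : ℝ) + (e : ℝ) ^ 2, (e : ℝ), 1],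
      ![(e : ℝ), 1 - m * (2 * (e : ℝ) + (e : ℝ) ^ 2), 2 * (e : ℝ) + (e : ℝ) ^ 2],
      ![((m + p + 3 : ℤ) : ℝ) * (e : ℝ) ^ 2 + (e : ℝ) ^ 3, (e : ℝ) ^ 2, (e : ℝ)],
      ![(e : ℝ) ^ 2, (e : ℝ) - (((m + p + 3 : ℤ) : ℝ) * (e : ℝ) ^ 2 + (e : ℝ) ^ 3),
        ((m + p + 3 : ℤ) : ℝ) * (e : ℝ) ^ 2 + (e : ℝ) ^ 3],
      ![(a + 2) * (e : ℝ) + (e : ℝ) ^ 2 - 1, (e : ℝ), 1]}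
    refine semiconvergent_of_stepsInto (U := U) (V := V) IsUnitMulTriangle.unit_mul ?_
      (by simp only [V, Set.mem_insert_iff, true_or]) hδ
    rintro v (rfl | rfl | rfl | rfl | rfl | rfl | rfl | rfl | rfl)
    · exact H.steps_initial ha (by simp only [V, Set.mem_insert_iff, true_or, or_true])
    · exact H.steps_from_e_one ha (by simp only [V, Set.mem_insert_iff, true_or, or_true])
    · exact H.steps_from_sq_e (by omega) (by simp only [V, Set.mem_insert_iff, true_or, or_true])
    · exact H.steps_from_one_t ha (by simp only [V, Set.mem_insert_iff, true_or, or_true])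
    · refine H.steps_from_add_sq_e (m := m) (by omega) ?_ ?_
        (by simp only [V, Set.mem_insert_iff, true_or, or_true])
      · nlinarith
      · nlinarith
    · refine H.steps_from_e_add_sq (m := m) (p := p) (by omega) (by omega) (by omega) ?_ ?_
        ⟨1, U.one_mem, _, show ![((m + p + 3 : ℤ) : ℝ) * (e : ℝ) ^ 2 + (e : ℝ) ^ 3, (e : ℝ) ^ 2,
          (e : ℝ)] ∈ V by simp only [V, Set.mem_insert_iff, true_or, or_true], ?_⟩
      · linarith
      · linarith
      · rw [hbm, Units.val_one, one_smul]
    · exact H.steps_from_add_cube (by omega) (by omega) (by omega)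
        (by simp only [V, Set.mem_insert_iff, true_or, or_true])
    · exact H.steps_from_sq_sub_cube (by omega) (by omega) (by omega)
        (by simp only [V, Set.mem_insert_iff, Set.mem_singleton_iff, or_true])
    · exact H.steps_return (by omega) (by simp only [V, Set.mem_insert_iff, true_or, or_true])

end CubicUnits

/-! ### The exceptional expansions for `a = 0` and `a = -1`. -/

namespace CubicUnits

variable {U : Subgroup ℝˣ} {a : ℤ} {e t : ℝˣ}

/-- Now `2e + e² > 1`, so `t²` has first digit 2, and the expansion enters a cycle of three vectors.
-/
theorem semiconvergent_of_eq_zero (H : CubicUnits U 0 e t) {δ : ℝ}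
    (hδ : IsSemiconvergent ![1, 1 + (e : ℝ), (1 + (e : ℝ)) ^ 2] δ) :
    IsUnitMulTriangle U 0 t δ := by
  have he := H.pos
  have R := H.rel
  have h1 := H.one_lt le_rfl
  have h2 := H.div_pos'
  have h3 := H.one_sub_pos
  have h4 := H.div_lt
  simp only [Int.cast_zero, zero_add, one_mul, zero_mul] at R h1 h2 h3 h4
  let V : Set (Fin 3 → ℝ) := {![1, 1 + (e : ℝ), (1 + (e : ℝ)) ^ 2],
    ![(e : ℝ), 2 * (e : ℝ) + (e : ℝ) ^ 2 - 1, 1],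
    ![1, 2 * (e : ℝ) + (e : ℝ) ^ 2, 1 + (e : ℝ)],
    ![(((0 : ℤ) : ℝ) + 2) * (e : ℝ) + (e : ℝ) ^ 2 - 1, (e : ℝ), 1],
    ![(e : ℝ) ^ 2, 1 - (((0 : ℤ) : ℝ) + 1) * (e : ℝ), (e : ℝ)]}
  have hw : ((e * t⁻¹ : ℝˣ) : ℝ) = 2 * (e : ℝ) + (e : ℝ) ^ 2 - 1 := by
    rw [H.val_div]; push_cast; ring
  have hwU : e * t⁻¹ ∈ U := U.mul_mem H.mem_e (U.inv_mem H.mem_t)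
  have hsq : IsUnitMulTriangle U 0 t (2 * (e : ℝ) + (e : ℝ) ^ 2) := H.two_mul_add (by norm_num)
  refine semiconvergent_of_stepsInto (U := U) (V := V) IsUnitMulTriangle.unit_mul ?_
    (by simp only [V, Set.mem_insert_iff, true_or]) hδ
  rintro v (rfl | rfl | rfl | rfl | rfl)
  · show StepsInto _ _ _ 1 (1 + (e : ℝ)) ((1 + (e : ℝ)) ^ 2)
    refine ⟨1, 2, one_pos, ?_, ?_, ?_, ?_, ?_, ?_, 1, U.one_mem,
      ![(e : ℝ), 2 * (e : ℝ) + (e : ℝ) ^ 2 - 1, 1],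
      by simp only [V, Set.mem_insert_iff, true_or, or_true], ?_⟩
    · push_cast; linarith
    · push_cast; nlinarith
    · push_cast; nlinarith
    · push_cast; nlinarith
    · intro j h h'
      obtain rfl : j = 0 := by omega
      simpa using H.self_t
    · intro j h h'
      obtain rfl | rfl : j = 0 ∨ j = 1 := by omega
      · exact isUnitMulTriangle_congr (H.self_t.unit_mul t H.mem_t)
          (by rw [H.t_eq]; push_cast; ring)
      · exact isUnitMulTriangle_congr hsq (by push_cast; ring)
    · rw [smul_vec3]
      apply vec3_eq <;> (push_cast; ring)
  · show StepsInto _ _ _ (e : ℝ) (2 * (e : ℝ) + (e : ℝ) ^ 2 - 1) 1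
    refine ⟨0, 1, he, ?_, ?_, ?_, ?_, ?_, ?_, e * t⁻¹, hwU,
      ![1, 2 * (e : ℝ) + (e : ℝ) ^ 2, 1 + (e : ℝ)],
      by simp only [V, Set.mem_insert_iff, true_or, or_true], ?_⟩
    · push_cast; linarith
    · push_cast; linarith
    · push_cast; nlinarith
    · push_cast; linarith
    · intro j h h'
      omega
    · intro j h h'
      obtain rfl : j = 0 := by omega
      simpa using isUnitMulTriangle_one
    · rw [smul_vec3, hw]
      apply vec3_eq
      · push_cast; ring
      · push_cast; linear_combination (-1 - (e : ℝ)) * R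
      · linear_combination -R
  · show StepsInto _ _ _ 1 (2 * (e : ℝ) + (e : ℝ) ^ 2) (1 + (e : ℝ))
    refine ⟨1, 1, one_pos, ?_, ?_, ?_, ?_, ?_, ?_, 1, U.one_mem,
      ![(((0 : ℤ) : ℝ) + 2) * (e : ℝ) + (e : ℝ) ^ 2 - 1, (e : ℝ), 1],
      by simp only [V, Set.mem_insert_iff, true_or, or_true], ?_⟩
    · push_cast; linarith
    · push_cast; nlinarith
    · push_cast; nlinarith
    · push_cast; nlinarith
    · intro j h h'
      obtain rfl : j = 0 := by omega
      simpa using hsq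
    · intro j h h'
      obtain rfl : j = 0 := by omega
      simpa using H.self_t
    · rw [smul_vec3]
      apply vec3_eq <;> (push_cast; ring)
  · exact H.steps_return le_rfl
      (by simp only [V, Set.mem_insert_iff, Set.mem_singleton_iff, or_true])
  · exact H.steps_from_sq_e le_rfl (by simp only [V, Set.mem_insert_iff, true_or, or_true])

/-- Now `3 < t² < 4`, and `t² - 3 = e / t²` is a unit; after the start the expansion alternates
between two vectors. -/
theorem semiconvergent_of_eq_neg_one (H : CubicUnits U (-1) e t) {δ : ℝ}
    (hδ : IsSemiconvergent ![1, 1 + (e : ℝ), (1 + (e : ℝ)) ^ 2] δ) :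
    IsUnitMulTriangle U (-1) t δ := by
  have he := H.pos
  have R := H.rel
  have h1 := H.lt_one le_rfl
  push_cast at R
  let V : Set (Fin 3 → ℝ) := {![1, 1 + (e : ℝ), (1 + (e : ℝ)) ^ 2],
    ![(e : ℝ), (1 + (e : ℝ)) ^ 2 - 3, 1], ![1, (e : ℝ), (1 + (e : ℝ)) ^ 2]}
  have hmul : ((1 + (e : ℝ)) ^ 2 - 3) * (1 + e) ^ 2 = e := by
    linear_combination (2 + (e : ℝ)) * R
  have hval : ((e * (t ^ 2)⁻¹ : ℝˣ) : ℝ) = (1 + (e : ℝ)) ^ 2 - 3 := by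
    rw [Units.val_mul, Units.val_inv_eq_inv_val, ← div_eq_mul_inv, div_eq_iff (t ^ 2).ne_zero,
      Units.val_pow_eq_pow_val, H.t_eq, hmul]
  have hmem : e * (t ^ 2)⁻¹ ∈ U := U.mul_mem H.mem_e (U.inv_mem (U.pow_mem H.mem_t 2))
  have hpos : 0 < (1 + (e : ℝ)) ^ 2 - 3 := by
    by_contra! h
    nlinarith [sq_nonneg (1 + (e : ℝ))]
  have hsq : IsUnitMulTriangle U (-1) t ((1 + (e : ℝ)) ^ 2) :=
    isUnitMulTriangle_congr (H.self_t.unit_mul t H.mem_t) (by rw [H.t_eq]; ring)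
  have hsq1 : IsUnitMulTriangle U (-1) t ((1 + (e : ℝ)) ^ 2 - 1) :=
    isUnitMulTriangle_congr (H.two_mul_add le_rfl) (by ring)
  -- For `a = -1` the cubic relation reads `(t² - 2) e = 1`.
  have hsq2 : IsUnitMulTriangle U (-1) t ((1 + (e : ℝ)) ^ 2 - 2) :=
    isUnitMulTriangle_of_mul_eq_unit H.mem_e U.one_mem
      (by push_cast; linear_combination R)
  have hsemi : ∀ j : ℤ, 0 ≤ j → j < 3 →
      IsUnitMulTriangle U (-1) t ((1 + (e : ℝ)) ^ 2 - j * 1) := by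
    intro j h h'
    obtain rfl | rfl | rfl : j = 0 ∨ j = 1 ∨ j = 2 := by omega
    · simpa using hsq
    · simpa using hsq1
    · simpa using hsq2
  refine semiconvergent_of_stepsInto (U := U) (V := V) IsUnitMulTriangle.unit_mul ?_
    (by simp only [V, Set.mem_insert_iff, true_or]) hδ
  rintro v (rfl | rfl | rfl)
  · show StepsInto _ _ _ 1 (1 + (e : ℝ)) ((1 + (e : ℝ)) ^ 2)
    refine ⟨1, 3, one_pos, ?_, ?_, ?_, ?_, ?_, hsemi, 1, U.one_mem,
      ![(e : ℝ), (1 + (e : ℝ)) ^ 2 - 3, 1],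
      by simp only [V, Set.mem_insert_iff, true_or, or_true], ?_⟩
    · push_cast; linarith
    · push_cast; linarith
    · push_cast; linarith
    · push_cast; nlinarith
    · intro j h h'
      obtain rfl : j = 0 := by omega
      simpa using H.self_t
    · rw [smul_vec3]
      apply vec3_eq <;> (push_cast; ring)
  · show StepsInto _ _ _ (e : ℝ) ((1 + (e : ℝ)) ^ 2 - 3) 1
    refine ⟨0, 1, he, ?_, ?_, ?_, ?_, ?_, ?_, e * (t ^ 2)⁻¹, hmem,
      ![1, (e : ℝ), (1 + (e : ℝ)) ^ 2],
      by simp only [V, Set.mem_insert_iff, Set.mem_singleton_iff, or_true], ?_⟩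
    · push_cast; linarith
    · push_cast; nlinarith
    · push_cast; linarith
    · push_cast; nlinarith
    · intro j h h'
      omega
    · intro j h h'
      obtain rfl : j = 0 := by omega
      simpa using isUnitMulTriangle_one
    · rw [smul_vec3, hval]
      apply vec3_eq
      · push_cast; ring
      · push_cast; linear_combination -R
      · rw [hmul]
  · show StepsInto _ _ _ 1 (e : ℝ) ((1 + (e : ℝ)) ^ 2)
    refine ⟨0, 3, one_pos, ?_, ?_, ?_, ?_, ?_, hsemi, 1, U.one_mem,
      ![(e : ℝ), (1 + (e : ℝ)) ^ 2 - 3, 1],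
      by simp only [V, Set.mem_insert_iff, true_or, or_true], ?_⟩
    · push_cast; linarith
    · push_cast; linarith
    · push_cast; linarith
    · push_cast; nlinarith
    · intro j h h'
      omega
    · rw [smul_vec3]
      apply vec3_eq <;> (push_cast; ring)

theorem semiconvergent (H : CubicUnits U a e t) (ha : -1 ≤ a) {δ : ℝ}
    (hδ : IsSemiconvergent ![1, (t : ℝ), (t : ℝ) ^ 2] δ) : IsUnitMulTriangle U a t δ := by
  rw [H.t_eq] at hδ
  obtain rfl | rfl | h : a = -1 ∨ a = 0 ∨ 1 ≤ a := by omega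
  · exact H.semiconvergent_of_eq_neg_one hδ
  · exact H.semiconvergent_of_eq_zero hδ
  · exact H.semiconvergent_of_one_le h hδ

end CubicUnits

/-! ### The simplest cubic order -/

section Ring

variable {R : Type*} [CommRing R] {a : ℤ}

theorem simplestCubic_mul_inv {x : R} (hx : x ^ 3 - a * x ^ 2 - (a + 3) * x - 1 = 0) :
    (x ^ 2 - a * x - (a + 3)) * x = 1 := by
  linear_combination hx

theorem simplestCubic_inv {x : R} (hx : x ^ 3 - a * x ^ 2 - (a + 3) * x - 1 = 0) :
    a * (x ^ 2 - a * x - (a + 3)) + (a + 3) * (x ^ 2 - a * x - (a + 3)) ^ 2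
      + (x ^ 2 - a * x - (a + 3)) ^ 3 = 1 := by
  have h := simplestCubic_mul_inv hx
  set e := x ^ 2 - a * x - (a + 3)
  have h0 : e ^ 3 * (x ^ 3 - a * x ^ 2 - (a + 3) * x - 1) = 0 := by rw [hx, mul_zero]
  have h2 : e ^ 2 * x ^ 2 = 1 := by rw [← mul_pow, h, one_pow]
  have h3 : e ^ 3 * x ^ 3 = 1 := by rw [← mul_pow, h, one_pow]
  linear_combination h3 - a * e * h2 - (a + 3) * e ^ 2 * h - h0

theorem simplestCubic_one_add_inv {x : R} (hx : x ^ 3 - a * x ^ 2 - (a + 3) * x - 1 = 0) :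
    (1 + (x ^ 2 - a * x - (a + 3))) * (a + 2 + (x ^ 2 - a * x - (a + 3)) - x) = 1 := by
  have h := simplestCubic_mul_inv hx
  have h1 := simplestCubic_inv hx
  set e := x ^ 2 - a * x - (a + 3) with he
  have h2 : x = a + (a + 3) * e + e ^ 2 := by
    linear_combination -x * h1 + (a + (a + 3) * e + e ^ 2) * h
  rw [h2]
  linear_combination -h1

/-- The negative of the conjugate root `-1 - 1/x`. -/
theorem simplestCubic_neg_conj {x : R} (hx : x ^ 3 - a * x ^ 2 - (a + 3) * x - 1 = 0) :
    (1 + (x ^ 2 - a * x - (a + 3))) ^ 3 + a * (1 + (x ^ 2 - a * x - (a + 3))) ^ 2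
      - (a + 3) * (1 + (x ^ 2 - a * x - (a + 3))) + 1 = 0 := by
  linear_combination simplestCubic_inv hx

/-- The quadratic expression is `(s - 1)⁻¹`: it inverts the passage `x ↦ 1 + 1/x` from a root to the
negative of a conjugate. -/
theorem simplestCubic_of_neg_conj {s : R} (hs : s ^ 3 + a * s ^ 2 - (a + 3) * s + 1 = 0) :
    (s ^ 2 + (a + 1) * s - 2) ^ 3 - a * (s ^ 2 + (a + 1) * s - 2) ^ 2
        - (a + 3) * (s ^ 2 + (a + 1) * s - 2) - 1 = 0 ∧
      1 + ((s ^ 2 + (a + 1) * s - 2) ^ 2 - a * (s ^ 2 + (a + 1) * s - 2) - (a + 3)) = s := by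
  have h1 : (s ^ 2 + (a + 1) * s - 2) * (s - 1) = 1 := by linear_combination hs
  have h2 : (s ^ 2 + (a + 1) * s - 2) ^ 2 - a * (s ^ 2 + (a + 1) * s - 2) - (a + 3) = s - 1 := by
    linear_combination (s + a + 2) * hs
  refine ⟨?_, by rw [h2]; ring⟩
  linear_combination (s ^ 2 + (a + 1) * s - 2) * h2 + h1

end Ring

/-! ### Real conjugates, total positivity and the positive functional. -/

section Real

variable {a : ℤ} {e : ℝ}

/-- The negatives of the conjugates of `ρ = e⁻¹`. -/
theorem simplestCubic_neg_conj_cases (he : 0 < e) (R : a * e + (a + 3) * e ^ 2 + e ^ 3 = 1) {s : ℝ} :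
    s ^ 3 + a * s ^ 2 - (a + 3) * s + 1 = 0 ↔ s = 1 + e ∨ s = -e⁻¹ ∨ s = e / (1 + e) := by
  have h1 : (1 + e) ≠ 0 := by positivity
  -- Eliminating `a` makes the factorization a rational identity in `e`.
  have ha : (a : ℝ) = (1 - 3 * e ^ 2 - e ^ 3) / (e * (1 + e)) := by
    field_simp
    linear_combination R
  have h : s ^ 3 + a * s ^ 2 - (a + 3) * s + 1 = (s - (1 + e)) * (s - -e⁻¹) * (s - e / (1 + e)) := by
    rw [ha]
    field_simp
    ring
  rw [h, mul_eq_zero, mul_eq_zero, sub_eq_zero, sub_eq_zero, sub_eq_zero, or_assoc]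

theorem trianglePoly_pos (he : 0 < e) (R : a * e + (a + 3) * e ^ 2 + e ^ 3 = 1) {v W : ℤ}
    (hv : 0 ≤ v) (hW : 0 ≤ W) (hvW : v + W ≤ a) {s : ℝ}
    (hs : s ^ 3 + a * s ^ 2 - (a + 3) * s + 1 = 0) : 0 < trianglePoly a v W s := by
  have hv' : (0 : ℝ) ≤ v := by exact_mod_cast hv
  have hW' : (0 : ℝ) ≤ W := by exact_mod_cast hW
  have hvW' : (v : ℝ) + W ≤ a := by exact_mod_cast hvW
  have hw : ((a + 2) * e + e ^ 2 - 1) * (1 + e) = e := by linear_combination R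
  have hw0 : 0 < (a + 2) * e + e ^ 2 - 1 := by
    by_contra! h
    nlinarith
  unfold trianglePoly
  rcases (simplestCubic_neg_conj_cases he R).1 hs with rfl | rfl | rfl
  · have h1 : 0 ≤ (v : ℝ) * ((a + 2) * (1 + e) - 1) := mul_nonneg hv' (by nlinarith)
    have h2 : 0 < (1 + W) * (1 + e) := by positivity
    have h3 : 0 < (v + 1) * (1 + e) ^ 2 := by positivity
    nlinarith
  · have h1 : -(v : ℝ) + (v * (a + 2) + 1 + W) * -e⁻¹ + (v + 1) * (-e⁻¹) ^ 2 =
        (-v * e ^ 2 - (v * (a + 2) + 1 + W) * e + (v + 1)) / e ^ 2 := by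
      field_simp
      ring
    rw [h1]
    apply div_pos _ (by positivity)
    -- With `w = e/t`, the numerator becomes `e² + (v+1) e w + (a - v - W) e`; here `v + W ≤ a`
    -- enters.
    have h2 : 1 - (a + 1) * e = e ^ 2 + e * ((a + 2) * e + e ^ 2 - 1) := by
      linear_combination -R
    have h3 : 0 < e * ((a + 2) * e + e ^ 2 - 1) := by positivity
    have h4 : 0 ≤ (v : ℝ) * (e * ((a + 2) * e + e ^ 2 - 1)) := by positivity
    have h5 : 0 ≤ (a - v - W) * e := mul_nonneg (by linarith) he.le
    have h6 : 0 < e ^ 2 := by positivity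
    nlinarith
  · have h1 : -(v : ℝ) + (v * (a + 2) + 1 + W) * (e / (1 + e)) + (v + 1) * (e / (1 + e)) ^ 2 =
        (-v * (1 + e) ^ 2 + (v * (a + 2) + 1 + W) * (e * (1 + e)) + (v + 1) * e ^ 2)
          / (1 + e) ^ 2 := by
      field_simp
    rw [h1]
    apply div_pos _ (by positivity)
    have h2 : 0 ≤ (W : ℝ) * (e * (1 + e)) := by positivity
    have h3 : 0 ≤ ((a : ℝ) - v) * e ^ 2 := mul_nonneg (by linarith) (by positivity)
    have h4 : 0 < e * (1 + e) := by positivity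
    nlinarith [mul_pos he he, mul_nonneg hv' he.le, mul_nonneg hv' (sq_nonneg e)]

/-- The functional `p + q s + r s² ↦ p + r` is a combination with positive coefficients of the
evaluations at the three roots. -/
theorem exists_weights (he : 0 < e) : ∃ c₁ c₂ c₃ : ℝ, 0 < c₁ ∧ 0 < c₂ ∧ 0 < c₃ ∧ ∀ p q r : ℝ,
    c₁ * (p + q * (1 + e) + r * (1 + e) ^ 2) + c₂ * (p + q * -e⁻¹ + r * (-e⁻¹) ^ 2) +
      c₃ * (p + q * (e / (1 + e)) + r * (e / (1 + e)) ^ 2) = p + r := by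
  have hd : 0 < 1 + e + e ^ 2 := by positivity
  -- Lagrange interpolation at the roots `sᵢ`: the weight at `sᵢ` is `(1 + sⱼ sₖ) / ((sᵢ - sⱼ)(sᵢ -
  -- sₖ))`.
  refine ⟨e ^ 2 / (1 + e + e ^ 2) ^ 2, e ^ 2 * (1 + e) ^ 2 / (1 + e + e ^ 2) ^ 2,
    (1 + e) ^ 2 / (1 + e + e ^ 2) ^ 2, by positivity, by positivity, by positivity, ?_⟩
  intro p q r
  field_simp
  ring

end Real

/-! ### The field `ℚ(ρ)` and its real embeddings -/

section Field

open Polynomial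

theorem simplestCubic_irreducible (a : ℤ) :
    Irreducible ((X ^ 3 - C a * X ^ 2 - C (a + 3) * X - 1 : ℤ[X]).map (algebraMap ℤ ℚ)) := by
  have hm : (X ^ 3 - C a * X ^ 2 - C (a + 3) * X - 1 : ℤ[X]).Monic := by monicity!
  have hd : (X ^ 3 - C a * X ^ 2 - C (a + 3) * X - 1 : ℤ[X]).natDegree = 3 := by compute_degree!
  rw [← hm.irreducible_iff_irreducible_map_fraction_map,
    hm.irreducible_iff_roots_eq_zero_of_degree_le_three (by omega) (by omega)]
  refine Multiset.eq_zero_of_forall_notMem fun n hn => ?_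
  have h : n ^ 3 - a * n ^ 2 - (a + 3) * n - 1 = 0 := by
    simpa using (mem_roots'.1 hn).2
  have hu : n * (n ^ 2 - a * n - (a + 3)) = 1 := by linear_combination h
  -- The values at `1` and `-1` are `-(2a + 3)`, which is odd, and `1`.
  rcases Int.eq_one_or_neg_one_of_mul_eq_one hu with rfl | rfl <;> omega

theorem exists_embedding {a : ℤ} {ρ x : ℝ} (hρ : ρ ^ 3 - a * ρ ^ 2 - (a + 3) * ρ - 1 = 0)
    (hx : x ^ 3 - a * x ^ 2 - (a + 3) * x - 1 = 0) :
    ∃ σ : realField ρ →+* ℝ, σ (IntermediateField.AdjoinSimple.gen ℚ ρ) = x := by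
  set f := (X ^ 3 - C a * X ^ 2 - C (a + 3) * X - 1 : ℤ[X]).map (algebraMap ℤ ℚ) with hf
  have hm : (X ^ 3 - C a * X ^ 2 - C (a + 3) * X - 1 : ℤ[X]).Monic := by monicity!
  have hroot : ∀ y : ℝ, y ^ 3 - a * y ^ 2 - (a + 3) * y - 1 = 0 → aeval y f = 0 := by
    intro y hy
    have h3 : (aeval y) (3 : ℚ[X]) = 3 := map_ofNat _ 3
    simpa [hf, h3] using hy
  have hmin : minpoly ℚ ρ = f :=
    (minpoly.eq_of_irreducible_of_monic (simplestCubic_irreducible a) (hroot ρ hρ) (hm.map _)).symm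
  have hint : IsIntegral ℚ ρ := ⟨f, hm.map _, hroot ρ hρ⟩
  have hmem : x ∈ (minpoly ℚ ρ).aroots ℝ := by
    rw [hmin, mem_aroots]
    exact ⟨(hm.map _).ne_zero, hroot x hx⟩
  exact ⟨((IntermediateField.algHomAdjoinIntegralEquiv ℚ hint).symm ⟨x, hmem⟩ :
      realField ρ →ₐ[ℚ] ℝ), IntermediateField.algHomAdjoinIntegralEquiv_symm_apply_gen ℚ hint _⟩

end Field

section Order

variable {a : ℤ} {ρ : ℝ}

local notation "gen" => IntermediateField.AdjoinSimple.gen ℚ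

theorem gen_root (hρ : ρ ^ 3 - a * ρ ^ 2 - (a + 3) * ρ - 1 = 0) :
    (gen ρ) ^ 3 - a * (gen ρ) ^ 2 - (a + 3) * gen ρ - 1 = 0 := by
  apply Subtype.val_injective
  have h3 : ((3 : realField ρ) : ℝ) = 3 := rfl
  simpa [h3] using hρ

/-- The inverse of `ρ` as an element of `ℚ(ρ)`. -/
noncomputable def genInv (a : ℤ) (ρ : ℝ) : realField ρ := (gen ρ) ^ 2 - a * gen ρ - (a + 3)

theorem gen_mem : gen ρ ∈ realOrder ρ := Algebra.subset_adjoin rfl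

theorem genInv_mem : genInv a ρ ∈ realOrder ρ := by
  refine sub_mem (sub_mem (pow_mem gen_mem 2) (mul_mem (intCast_mem _ a) gen_mem)) ?_
  exact_mod_cast intCast_mem (realOrder ρ) (a + 3)

/-- `ρ⁻¹` as a unit of `ℤ[ρ]`. -/
noncomputable def invUnit (hρ : ρ ^ 3 - a * ρ ^ 2 - (a + 3) * ρ - 1 = 0) : (realOrder ρ)ˣ where
  val := ⟨genInv a ρ, genInv_mem⟩
  inv := ⟨gen ρ, gen_mem⟩
  val_inv := Subtype.ext (simplestCubic_mul_inv (gen_root hρ))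
  inv_val := Subtype.ext ((mul_comm _ _).trans (simplestCubic_mul_inv (gen_root hρ)))

/-- `1 + ρ⁻¹` as a unit of `ℤ[ρ]`. -/
noncomputable def oneAddInvUnit (hρ : ρ ^ 3 - a * ρ ^ 2 - (a + 3) * ρ - 1 = 0) :
    (realOrder ρ)ˣ where
  val := ⟨1 + genInv a ρ, add_mem (one_mem _) genInv_mem⟩
  inv := ⟨a + 2 + genInv a ρ - gen ρ, sub_mem (add_mem (by
    exact_mod_cast intCast_mem (realOrder ρ) (a + 2)) genInv_mem) gen_mem⟩
  val_inv := Subtype.ext (simplestCubic_one_add_inv (gen_root hρ))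
  inv_val := Subtype.ext ((mul_comm _ _).trans (simplestCubic_one_add_inv (gen_root hρ)))

theorem exists_coords (hρ : ρ ^ 3 - a * ρ ^ 2 - (a + 3) * ρ - 1 = 0) {y : realField ρ}
    (hy : y ∈ realOrder ρ) :
    ∃ p q r : ℤ, y = p + q * (1 + genInv a ρ) + r * (1 + genInv a ρ) ^ 2 := by
  have hc := simplestCubic_neg_conj (gen_root hρ)
  have hg := simplestCubic_mul_inv (gen_root hρ)
  have ht : 1 + genInv a ρ = 1 + ((gen ρ) ^ 2 - a * gen ρ - (a + 3)) := rfl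
  rw [← ht] at hc
  rw [show (gen ρ) ^ 2 - a * gen ρ - (a + 3) = genInv a ρ from rfl] at hg
  generalize genInv a ρ = e at *
  induction hy using Algebra.adjoin_induction with
  | mem x hx =>
    obtain rfl : x = gen ρ := hx
    -- This is `ρ = (t - 1)⁻¹` expanded in powers of `t`.
    refine ⟨-2, a + 1, 1, ?_⟩
    push_cast
    linear_combination -gen ρ * hc + ((1 + e) ^ 2 + (a + 1) * (1 + e) - 2) * hg
  | algebraMap r => exact ⟨r, 0, 0, by simp⟩
  | add x y _ _ hx hy =>
    obtain ⟨p, q, r, rfl⟩ := hx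
    obtain ⟨p', q', r', rfl⟩ := hy
    exact ⟨p + p', q + q', r + r', by push_cast; ring⟩
  | mul x y _ _ hx hy =>
    obtain ⟨p, q, r, rfl⟩ := hx
    obtain ⟨p', q', r', rfl⟩ := hy
    -- The coefficients come from reducing `t³` and `t⁴` by the cubic for `t`.
    refine ⟨p * p' - (q * r' + r * q') + a * (r * r'),
      p * q' + q * p' + (a + 3) * (q * r' + r * q') - (a * (a + 3) + 1) * (r * r'),
      p * r' + q * q' + r * p' - a * (q * r' + r * q') + (a ^ 2 + a + 3) * (r * r'), ?_⟩
    push_cast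
    linear_combination ((q * r' + r * q') + (r * r') * ((1 + e) - a)) * hc

theorem map_one_add_genInv (hρ : ρ ^ 3 - a * ρ ^ 2 - (a + 3) * ρ - 1 = 0)
    (σ : realField ρ →+* ℝ) :
    σ (1 + genInv a ρ) ^ 3 + a * σ (1 + genInv a ρ) ^ 2 - (a + 3) * σ (1 + genInv a ρ) + 1 = 0 := by
  have h := congrArg σ (simplestCubic_neg_conj (gen_root hρ))
  have h3 : σ 3 = 3 := map_ofNat σ 3
  simpa [genInv, h3] using h

theorem exists_embedding_one_add_genInv (hρ : ρ ^ 3 - a * ρ ^ 2 - (a + 3) * ρ - 1 = 0) {s : ℝ}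
    (hs : s ^ 3 + a * s ^ 2 - (a + 3) * s + 1 = 0) :
    ∃ σ : realField ρ →+* ℝ, σ (1 + genInv a ρ) = s := by
  obtain ⟨h1, h2⟩ := simplestCubic_of_neg_conj hs
  obtain ⟨σ, h⟩ := exists_embedding hρ h1
  refine ⟨σ, ?_⟩
  have h3 : σ 3 = 3 := map_ofNat σ 3
  rw [← h2, ← h]
  simp [genInv, h3]

/-! ### Indecomposability -/

theorem signature_eq_totallyPositive {K : Type*} [Field K] {x : K} :
    signature x = totallyPositive K ↔ ∀ σ : K →+* ℝ, 0 < σ x := by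
  simp [funext_iff, signature, totallyPositive, sign_eq_one_iff]

theorem signature_mul {K : Type*} [Field K] (x y : K) :
    signature (x * y) = signature x * signature y := by
  funext σ
  simp [signature, sign_mul]

/-- Signatures are multiplicative, so multiplying a decomposition of `ε α` by `ε⁻¹` would give a
totally positive decomposition of `α`. -/
theorem IsSIndecomposable.unit_mul {K : Type*} [Field K] {O : Subalgebra ℤ K} {α : K}
    (h : IsSIndecomposable O (totallyPositive K) α) (ε : Oˣ) :
    IsSIndecomposable O (signature ((ε : O) * α : K)) ((ε : O) * α : K) := by
  obtain ⟨⟨hα, hs⟩, hind⟩ := h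
  have hinv : ((ε⁻¹ : Oˣ) : O) * ((ε : O) : K) = (1 : K) := by
    exact_mod_cast congrArg Subtype.val ε.inv_mul
  refine ⟨⟨mul_mem (ε : O).2 hα, rfl⟩, ?_⟩
  rintro ⟨y, hy, z, hz, hsy, hsz, hyz⟩
  have hback : ∀ w : K, signature w = signature ((ε : O) * α : K) →
      signature (((ε⁻¹ : Oˣ) : O) * w : K) = totallyPositive K := by
    intro w hw
    rw [signature_mul, hw, ← signature_mul, ← mul_assoc, hinv, one_mul, hs]
  refine hind ⟨_, mul_mem ((ε⁻¹ : Oˣ) : O).2 hy, _, mul_mem ((ε⁻¹ : Oˣ) : O).2 hz,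
    hback y hsy, hback z hsz, ?_⟩
  rw [← mul_add, ← hyz, ← mul_assoc, hinv, one_mul]

/-- A totally positive `p + q t + r t²` with `p + r = 1` is indecomposable. -/
theorem isSIndecomposable_of_add_eq_one (hρ : ρ ^ 3 - a * ρ ^ 2 - (a + 3) * ρ - 1 = 0)
    (hρ0 : 0 < ρ) {p q r : ℤ} (hpr : p + r = 1)
    (hpos : ∀ s : ℝ, s ^ 3 + a * s ^ 2 - (a + 3) * s + 1 = 0 → 0 < p + q * s + r * s ^ 2) :
    IsSIndecomposable (realOrder ρ) (totallyPositive (realField ρ))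
      (p + q * (1 + genInv a ρ) + r * (1 + genInv a ρ) ^ 2) := by
  have ht : (1 + genInv a ρ) ∈ realOrder ρ := add_mem (one_mem _) genInv_mem
  refine ⟨⟨add_mem (add_mem (intCast_mem _ p) (mul_mem (intCast_mem _ q) ht))
    (mul_mem (intCast_mem _ r) (pow_mem ht 2)), ?_⟩, ?_⟩
  · rw [signature_eq_totallyPositive]
    intro σ
    have := hpos _ (map_one_add_genInv hρ σ)
    simpa only [map_add, map_mul, map_pow, map_intCast] using this
  · rintro ⟨y, hy, z, hz, hsy, hsz, hyz⟩
    set e : ℝ := ρ ^ 2 - a * ρ - (a + 3)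
    have heρ : e * ρ = 1 := simplestCubic_mul_inv hρ
    have he : 0 < e := pos_of_mul_pos_left (heρ ▸ one_pos) hρ0.le
    have R : a * e + (a + 3) * e ^ 2 + e ^ 3 = 1 := simplestCubic_inv hρ
    obtain ⟨p₁, q₁, r₁, rfl⟩ := exists_coords hρ hy
    obtain ⟨p₂, q₂, r₂, rfl⟩ := exists_coords hρ hz
    have hroots := fun {s : ℝ} => simplestCubic_neg_conj_cases (s := s) he R
    obtain ⟨σ₁, h₁⟩ := exists_embedding_one_add_genInv hρ (hroots.2 (Or.inl rfl))
    obtain ⟨σ₂, h₂⟩ := exists_embedding_one_add_genInv hρ (hroots.2 (Or.inr (Or.inl rfl)))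
    obtain ⟨σ₃, h₃⟩ := exists_embedding_one_add_genInv hρ (hroots.2 (Or.inr (Or.inr rfl)))
    obtain ⟨c₁, c₂, c₃, hc₁, hc₂, hc₃, hc⟩ := exists_weights he
    have hL : ∀ p q r : ℤ, c₁ * σ₁ (p + q * (1 + genInv a ρ) + r * (1 + genInv a ρ) ^ 2) +
        c₂ * σ₂ (p + q * (1 + genInv a ρ) + r * (1 + genInv a ρ) ^ 2) +
        c₃ * σ₃ (p + q * (1 + genInv a ρ) + r * (1 + genInv a ρ) ^ 2) = ((p + r : ℤ) : ℝ) := by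
      intro p q r
      generalize 1 + genInv a ρ = τ at *
      simp only [map_add, map_mul, map_pow, map_intCast, h₁, h₂, h₃, hc, Int.cast_add]
    -- Total positivity makes the integer `p + r` positive, hence at least 1; two summands would
    -- then give at least 2.
    have hge : ∀ p q r : ℤ, signature (p + q * (1 + genInv a ρ) + r * (1 + genInv a ρ) ^ 2) =
        totallyPositive (realField ρ) → 1 ≤ p + r := by
      intro p q r h
      rw [signature_eq_totallyPositive] at h
      have h1 := h σ₁
      have h2 := h σ₂
      have h3 := h σ₃
      have : (0 : ℝ) < (p + r : ℤ) := by
        rw [← hL p q r]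
        positivity
      exact_mod_cast this
    have hy1 := hge _ _ _ hsy
    have hz1 := hge _ _ _ hsz
    have h := hL p q r
    rw [hyz, map_add σ₁, map_add σ₂, map_add σ₃] at h
    have hsum : ((p₁ + r₁ : ℤ) : ℝ) + ((p₂ + r₂ : ℤ) : ℝ) = ((p + r : ℤ) : ℝ) := by
      rw [← hL p₁ q₁ r₁, ← hL p₂ q₂ r₂, ← h]
      ring
    norm_cast at hsum
    omega

end Order

/-- The inclusion of the units of `ℤ[ρ]` into the units of `ℝ`. -/
noncomputable def realUnitsHom (ρ : ℝ) : (realOrder ρ)ˣ →* ℝˣ :=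
  Units.map (((realField ρ).val : realField ρ →+* ℝ).comp
    ((realOrder ρ).val : realOrder ρ →+* realField ρ) : realOrder ρ →* ℝ)

theorem coe_genInv (a : ℤ) (ρ : ℝ) : ((genInv a ρ : realField ρ) : ℝ) = ρ ^ 2 - a * ρ - (a + 3) := by
  have h3 : ((3 : realField ρ) : ℝ) = 3 := rfl
  simp [genInv, h3]

/-- The root `ρ'` of the cubic is `-1 - 1/ρ`. -/
theorem simplestCubic_conj_eq {a : ℤ} {ρ ρ' : ℝ} (hρ : ρ ^ 3 - a * ρ ^ 2 - (a + 3) * ρ - 1 = 0)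
    (hρ0 : 0 < ρ) (hρ' : ρ' ^ 3 - a * ρ' ^ 2 - (a + 3) * ρ' - 1 = 0) (hρ'_lt : ρ' < -1) :
    -ρ' = 1 + (ρ ^ 2 - a * ρ - (a + 3)) := by
  have heρ := simplestCubic_mul_inv hρ
  have R := simplestCubic_inv hρ
  set e := ρ ^ 2 - a * ρ - (a + 3)
  have he : 0 < e := pos_of_mul_pos_left (heρ ▸ one_pos) hρ0.le
  have hs : (-ρ') ^ 3 + a * (-ρ') ^ 2 - (a + 3) * (-ρ') + 1 = 0 := by linear_combination -hρ'
  -- Only `1 + e` exceeds 1 among the three candidates, while `-ρ' > 1`.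
  rcases (simplestCubic_neg_conj_cases he R).1 hs with h | h | h
  · exact h
  · have : 0 < e⁻¹ := inv_pos.2 he
    linarith
  · have : e / (1 + e) < 1 := by
      rw [div_lt_one (by positivity)]
      linarith
    linarith

theorem theorem8p1 (a : ℤ) (ha : -1 ≤ a) (ρ ρ' : ℝ)
    (hρ : ρ ^ 3 - a * ρ ^ 2 - (a + 3) * ρ - 1 = 0) (hρ_gt : a + 1 < ρ)
    (hρ' : ρ' ^ 3 - a * ρ' ^ 2 - (a + 3) * ρ' - 1 = 0) (hρ'_gt : -2 < ρ') (hρ'_lt : ρ' < -1)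
    (δ : ℝ) (hδ : IsSemiconvergent ![1, -ρ', ρ' ^ 2] δ) :
    ∃ x : realField ρ, (x : ℝ) = δ ∧
      IsSIndecomposable (realOrder ρ) (signature x) x ∧
      ∃ (ε : (realOrder ρ)ˣ) (α : realField ρ),
        IsSIndecomposable (realOrder ρ) (totallyPositive (realField ρ)) α ∧
        ((α : ℝ) = 1 ∨
          ∃ v W : ℕ, (v : ℤ) ≤ a ∧ (W : ℤ) ≤ a - v ∧ (α : ℝ) = triangleElement a v W ρ') ∧
        x = ((ε : realOrder ρ) : realField ρ) * α := by
  have hρ0 : 0 < ρ := by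
    have : (-1 : ℝ) ≤ a := by exact_mod_cast ha
    linarith
  have ht := simplestCubic_conj_eq hρ hρ0 hρ' hρ'_lt
  have heρ := simplestCubic_mul_inv hρ
  have R := simplestCubic_inv hρ
  have he : 0 < ρ ^ 2 - a * ρ - (a + 3) := pos_of_mul_pos_left (heρ ▸ one_pos) hρ0.le
  have htK : ((1 + genInv a ρ : realField ρ) : ℝ) = -ρ' := by
    rw [ht, ← coe_genInv]
    rfl
  -- Taking `U` to be the image of the units of `ℤ[ρ]` lets the final factor be lifted back to a
  -- unit of the order.
  have H : CubicUnits (realUnitsHom ρ).range a (realUnitsHom ρ (invUnit hρ)) (realUnitsHom ρ (oneAddInvUnit hρ)) :=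
    { mem_e := ⟨invUnit hρ, rfl⟩
      mem_t := ⟨oneAddInvUnit hρ, rfl⟩
      t_eq := rfl
      pos := by
        change 0 < ((genInv a ρ : realField ρ) : ℝ)
        rwa [coe_genInv]
      rel := by
        change a * ((genInv a ρ : realField ρ) : ℝ) + (a + 3) * ((genInv a ρ : realField ρ) : ℝ) ^ 2 +
          ((genInv a ρ : realField ρ) : ℝ) ^ 3 = 1
        rw [coe_genInv]
        exact R }
  have htval : ((realUnitsHom ρ (oneAddInvUnit hρ) : ℝˣ) : ℝ) = -ρ' := htK
  have hG := H.semiconvergent ha (δ := δ) (by rw [htval, neg_sq]; exact hδ)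
  rw [htval] at hG
  obtain ⟨-, ⟨ε, rfl⟩, h⟩ := hG
  have hcoe : ((realUnitsHom ρ ε : ℝˣ) : ℝ) = (((ε : realOrder ρ) : realField ρ) : ℝ) := rfl
  suffices hα : ∃ α : realField ρ, IsSIndecomposable (realOrder ρ) (totallyPositive (realField ρ)) α ∧
      ((α : ℝ) = 1 ∨
        ∃ v W : ℕ, (v : ℤ) ≤ a ∧ (W : ℤ) ≤ a - v ∧ (α : ℝ) = triangleElement a v W ρ') ∧
      δ = (((ε : realOrder ρ) : realField ρ) : ℝ) * α by
    obtain ⟨α, h1, h2, h3⟩ := hα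
    exact ⟨_, h3.symm, h1.unit_mul ε, ε, α, h1, h2, rfl⟩
  rcases h with h | ⟨v, W, hv, hW, hvW, h⟩
  · refine ⟨1, ?_, Or.inl rfl, by rw [h, hcoe]; simp⟩
    simpa using isSIndecomposable_of_add_eq_one hρ hρ0 (p := 1) (q := 0) (r := 0) rfl (by simp)
  · have hval : ((((-v : ℤ) : realField ρ) + ((v * (a + 2) + 1 + W : ℤ) : realField ρ) *
        (1 + genInv a ρ) + ((v + 1 : ℤ) : realField ρ) * (1 + genInv a ρ) ^ 2 : realField ρ) : ℝ) =
        trianglePoly a v W (-ρ') := by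
      have h2 : ((2 : realField ρ) : ℝ) = 2 := rfl
      rw [← htK]
      simp [trianglePoly, h2]
    refine ⟨_, isSIndecomposable_of_add_eq_one hρ hρ0 (p := -v) (q := v * (a + 2) + 1 + W)
      (r := v + 1) (by ring) ?_, Or.inr ⟨v.toNat, W.toNat, by omega, by omega, ?_⟩, ?_⟩
    · intro s hs
      simpa [trianglePoly] using trianglePoly_pos he R hv hW hvW hs
    · lift v to ℕ using hv
      lift W to ℕ using hW
      rw [hval]
      simp only [trianglePoly, triangleElement, Int.toNat_natCast]
      push_cast
      ring
    · rw [hval, h, hcoe]
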